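/- Let $d\ge 1$, let $\Omega\subset\mathbb{R}^d$ be a bounded open set and let $T>0$. Write $\|\cdot\|_\Omega$ and $(\cdot,\cdot)_\Omega$ for the norm and inner product of $L^2(\Omega)$ and of $L^2(\Omega;\mathbb{R}^d)$. Let $H^1_0(\Omega)$ be the closure of $C_0^\infty(\Omega)$ in $H^1(\Omega)$, and let $H^{-1}(\Omega)$ be its dual space, with the norm $\|\Phi\|_{H^{-1}(\Omega)}=\sup_{v\in H^1_0(\Omega)\setminus\{0\}}\langle\Phi,v\rangle/\|\nabla v\|_\Omega$. Let $L^2(\Omega)$ be embedded in $H^{-1}(\Omega)$ by $\langle w,v\rangle=(w,v)_\Omega$, and let $\Delta\colon H^1_0(\Omega)\to H^{-1}(\Omega)$ be the Laplacian, $\langle\Delta v,w\rangle=-(\nabla v,\nabla w)_\Omega$. Let $$Y=L^2(0,T;H^1_0(\Omega))\cap H^1(0,T;H^{-1}(\Omega)),$$ the space of those $\varphi\in L^2(0,T;H^1_0(\Omega))$ which, as $H^{-1}(\Omega)$-valued functions, have a weak time derivative $\partial_t\varphi\in L^2(0,T;H^{-1}(\Omega))$. Every $\varphi\in Y$ has a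 unique representative in $C([0,T];L^2(\Omega))$, through which $\varphi(0),\varphi(T)\in L^2(\Omega)$ are defined. Define the time-symmetric norm on $Y$ by $$\|\varphi\|_{Y_*}^2=\int_0^T\left(\|\partial_t\varphi\|_{H^{-1}(\Omega)}^2+\|\nabla\varphi\|_\Omega^2\right)dt+\|\varphi(0)\|_\Omega^2+\|\varphi(T)\|_\Omega^2 .$$ Then, for every $\varphi\in Y$, all the integrals below and above are finite and $$\|\varphi\|_{Y_*}^2=2\|\varphi(T)\|_\Omega^2+\int_0^T\|(\partial_t+\Delta)\varphi\|_{H^{-1}(\Omega)}^2\,dt .$$ -/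

import Mathlib

open MeasureTheory Set

noncomputable section

namespace HeatSpaces

section Spatial

variable {d : ℕ}

/-- `L²(Ω; F)` with respect to Lebesgue measure on `Ω ⊆ ℝᵈ`. -/
abbrev L2 (Ω : TopologicalSpace.Opens (EuclideanSpace ℝ (Fin d)))
    (F : Type*) [NormedAddCommGroup F] : Type _ :=
  Lp F 2 (volume.restrict (Ω : Set (EuclideanSpace ℝ (Fin d))))

/-- `C₀^∞(Ω)`: real-valued smooth functions with compact support contained in `Ω`. -/
abbrev Test (Ω : TopologicalSpace.Opens (EuclideanSpace ℝ (Fin d))) : Type _ :=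
  TestFunction Ω ℝ ⊤

/-- The classical partial derivative `∂ᵢ ψ`. -/
def partialDeriv (i : Fin d) (ψ : EuclideanSpace ℝ (Fin d) → ℝ)
    (x : EuclideanSpace ℝ (Fin d)) : ℝ :=
  fderiv ℝ ψ x (EuclideanSpace.single i 1)

/-- `g ∈ L²(Ω; ℝᵈ)` is the weak gradient of `v ∈ L²(Ω)`. -/
def IsWeakGrad (Ω : TopologicalSpace.Opens (EuclideanSpace ℝ (Fin d)))
    (v : L2 Ω ℝ) (g : L2 Ω (EuclideanSpace ℝ (Fin d))) : Prop :=
  ∀ (ψ : Test Ω) (i : Fin d),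
    ∫ x in (Ω : Set (EuclideanSpace ℝ (Fin d))), v x * partialDeriv i ψ x
      = - ∫ x in (Ω : Set (EuclideanSpace ℝ (Fin d))), g x i * ψ x

variable {Ω : TopologicalSpace.Opens (EuclideanSpace ℝ (Fin d))}

theorem memLp_test (ψ : Test Ω) :
    MemLp ψ 2 (volume.restrict (Ω : Set (EuclideanSpace ℝ (Fin d)))) :=
  (ψ.continuous.memLp_of_hasCompactSupport ψ.hasCompactSupport)

theorem memLp_partialDeriv (ψ : Test Ω) (i : Fin d) :
    MemLp (partialDeriv i ψ) 2 (volume.restrict (Ω : Set (EuclideanSpace ℝ (Fin d)))) := by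
  have hc : Continuous (partialDeriv i ψ) :=
    (ψ.contDiff.continuous_fderiv (by simp)).clm_apply continuous_const
  refine hc.memLp_of_hasCompactSupport ?_
  exact ψ.hasCompactSupport.fderiv_apply (𝕜 := ℝ) _

theorem integrable_mul_partialDeriv (v : L2 Ω ℝ) (ψ : Test Ω) (i : Fin d) :
    Integrable (fun x => v x * partialDeriv i ψ x)
      (volume.restrict (Ω : Set (EuclideanSpace ℝ (Fin d)))) :=
  (Lp.memLp v).integrable_mul (memLp_partialDeriv ψ i)

theorem integrable_coord_mul (g : L2 Ω (EuclideanSpace ℝ (Fin d))) (ψ : Test Ω) (i : Fin d) :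
    Integrable (fun x => g x i * ψ x)
      (volume.restrict (Ω : Set (EuclideanSpace ℝ (Fin d)))) :=
  MemLp.integrable_mul
    ((EuclideanSpace.proj (𝕜 := ℝ) i).comp_memLp' (Lp.memLp g)) (memLp_test ψ)

theorem IsWeakGrad.add {v v' : L2 Ω ℝ} {g g' : L2 Ω (EuclideanSpace ℝ (Fin d))}
    (h : IsWeakGrad Ω v g) (h' : IsWeakGrad Ω v' g') : IsWeakGrad Ω (v + v') (g + g') := by
  intro ψ i
  have e1 : ∫ x in (Ω : Set (EuclideanSpace ℝ (Fin d))), (v + v') x * partialDeriv i ψ x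
      = ∫ x in (Ω : Set (EuclideanSpace ℝ (Fin d))),
          (v x * partialDeriv i ψ x + v' x * partialDeriv i ψ x) := by
    refine integral_congr_ae ?_
    filter_upwards [Lp.coeFn_add v v'] with x hx
    rw [hx, Pi.add_apply, add_mul]
  have e2 : ∫ x in (Ω : Set (EuclideanSpace ℝ (Fin d))), (g + g') x i * ψ x
      = ∫ x in (Ω : Set (EuclideanSpace ℝ (Fin d))), (g x i * ψ x + g' x i * ψ x) := by
    refine integral_congr_ae ?_
    filter_upwards [Lp.coeFn_add g g'] with x hx
    rw [hx, Pi.add_apply, PiLp.add_apply, add_mul]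
  rw [e1, e2, integral_add (integrable_mul_partialDeriv v ψ i) (integrable_mul_partialDeriv v' ψ i),
    integral_add (integrable_coord_mul g ψ i) (integrable_coord_mul g' ψ i), h ψ i, h' ψ i, neg_add]

theorem IsWeakGrad.smul {v : L2 Ω ℝ} {g : L2 Ω (EuclideanSpace ℝ (Fin d))}
    (c : ℝ) (h : IsWeakGrad Ω v g) : IsWeakGrad Ω (c • v) (c • g) := by
  intro ψ i
  have e1 : ∫ x in (Ω : Set (EuclideanSpace ℝ (Fin d))), (c • v) x * partialDeriv i ψ x
      = ∫ x in (Ω : Set (EuclideanSpace ℝ (Fin d))), c * (v x * partialDeriv i ψ x) := by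
    refine integral_congr_ae ?_
    filter_upwards [Lp.coeFn_smul c v] with x hx
    rw [hx, Pi.smul_apply, smul_eq_mul, mul_assoc]
  have e2 : ∫ x in (Ω : Set (EuclideanSpace ℝ (Fin d))), (c • g) x i * ψ x
      = ∫ x in (Ω : Set (EuclideanSpace ℝ (Fin d))), c * (g x i * ψ x) := by
    refine integral_congr_ae ?_
    filter_upwards [Lp.coeFn_smul c g] with x hx
    rw [hx, Pi.smul_apply, PiLp.smul_apply, smul_eq_mul, mul_assoc]
  rw [e1, e2, integral_const_mul, integral_const_mul, h ψ i, mul_neg]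

theorem IsWeakGrad.zero : IsWeakGrad Ω 0 0 := by
  intro ψ i
  have e1 : ∫ x in (Ω : Set (EuclideanSpace ℝ (Fin d))),
      (0 : L2 Ω ℝ) x * partialDeriv i ψ x = 0 := by
    refine integral_eq_zero_of_ae ?_
    filter_upwards [Lp.coeFn_zero ℝ 2 (volume.restrict (Ω : Set (EuclideanSpace ℝ (Fin d))))]
      with x hx
    simp only [hx, Pi.zero_apply, zero_mul]
  have e2 : ∫ x in (Ω : Set (EuclideanSpace ℝ (Fin d))),
      (0 : L2 Ω (EuclideanSpace ℝ (Fin d))) x i * ψ x = 0 := by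
    refine integral_eq_zero_of_ae ?_
    filter_upwards [Lp.coeFn_zero (EuclideanSpace ℝ (Fin d)) 2
      (volume.restrict (Ω : Set (EuclideanSpace ℝ (Fin d))))] with x hx
    simp only [hx, Pi.zero_apply, PiLp.zero_apply, zero_mul]
  rw [e1, e2, neg_zero]

variable (Ω)

/-- The Sobolev space `H¹(Ω)`, as the space of pairs `(v, ∇v)` with `v ∈ L²(Ω)` and weak gradient
`∇v ∈ L²(Ω; ℝᵈ)`. The norm is `‖v‖²_{H¹} = ‖v‖² + ‖∇v‖²` (the `ℓ²`-product norm). -/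
def H1 : Submodule ℝ (WithLp 2 (L2 Ω ℝ × L2 Ω (EuclideanSpace ℝ (Fin d)))) where
  carrier := {p | IsWeakGrad Ω p.fst p.snd}
  add_mem' h h' := h.add h'
  zero_mem' := IsWeakGrad.zero
  smul_mem' c _ h := h.smul c

/-- The elements of `H¹(Ω)` that are given by functions in `C₀^∞(Ω)`. -/
def testH1 : Submodule ℝ (H1 Ω) where
  carrier := {p | ∃ ψ : Test Ω,
    p.1.fst =ᵐ[volume.restrict (Ω : Set (EuclideanSpace ℝ (Fin d)))] ψ}
  add_mem' := by
    rintro p q ⟨ψ, hψ⟩ ⟨χ, hχ⟩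
    exact ⟨ψ + χ, (Lp.coeFn_add p.1.fst q.1.fst).trans (hψ.add hχ)⟩
  zero_mem' := ⟨0, Lp.coeFn_zero _ _ _⟩
  smul_mem' := by
    rintro c p ⟨ψ, hψ⟩
    exact ⟨c • ψ, (Lp.coeFn_smul c p.1.fst).trans (hψ.const_smul c)⟩

/-- `H¹₀(Ω)`, the closure of `C₀^∞(Ω)` in `H¹(Ω)`, as a subspace of `H¹(Ω)`. -/
def closureTestH1 : Submodule ℝ (H1 Ω) := (testH1 Ω).topologicalClosure

/-- `H¹₀(Ω)` as a type, with the inner product and norm of `H¹(Ω)`. -/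
def H10 : Type := closureTestH1 Ω

instance : NormedAddCommGroup (H10 Ω) :=
  inferInstanceAs (NormedAddCommGroup (closureTestH1 Ω))

instance : InnerProductSpace ℝ (H10 Ω) :=
  Submodule.innerProductSpace (closureTestH1 Ω)

/-- The inclusion `H¹₀(Ω) ⊆ H¹(Ω)`. -/
def toH1 : H10 Ω →L[ℝ] H1 Ω := (closureTestH1 Ω).subtypeL

/-- The inclusion `H¹₀(Ω) ⊆ L²(Ω)`. -/
def toL2 : H10 Ω →L[ℝ] L2 Ω ℝ :=
  WithLp.fstL 2 ℝ (L2 Ω ℝ) (L2 Ω (EuclideanSpace ℝ (Fin d)))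
    ∘L (H1 Ω).subtypeL ∘L toH1 Ω

/-- The (weak) gradient `∇ : H¹₀(Ω) → L²(Ω; ℝᵈ)`. -/
def grad : H10 Ω →L[ℝ] L2 Ω (EuclideanSpace ℝ (Fin d)) :=
  WithLp.sndL 2 ℝ (L2 Ω ℝ) (L2 Ω (EuclideanSpace ℝ (Fin d)))
    ∘L (H1 Ω).subtypeL ∘L toH1 Ω

/-- `H⁻¹(Ω)`, the space of bounded linear functionals on `H¹₀(Ω)`. Its built-in norm is the operator
norm for the full `H¹`-norm and serves only to define Bochner spaces; the norm that enters the
formulas is `normHneg`. -/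
abbrev Hneg : Type _ := StrongDual ℝ (H10 Ω)

variable {Ω} in
/-- `‖Φ‖_{H⁻¹} = sup_{v ∈ H¹₀ ∖ {0}} ⟨Φ, v⟩ / ‖∇v‖`. -/
def normHneg (Φ : Hneg Ω) : ℝ :=
  ⨆ v : {v : H10 Ω // v ≠ 0}, Φ v.1 / ‖grad Ω v.1‖

/-- The embedding `L²(Ω) ⊆ H⁻¹(Ω)`, `⟨w, v⟩ = (w, v)_{L²(Ω)}`. -/
def embHneg : L2 Ω ℝ →L[ℝ] Hneg Ω :=
  (innerSL ℝ (E := L2 Ω ℝ)).bilinearComp (ContinuousLinearMap.id ℝ (L2 Ω ℝ)) (toL2 Ω)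

/-- The Laplacian `Δ : H¹₀(Ω) → H⁻¹(Ω)`, `⟨Δv, w⟩ = -(∇v, ∇w)`. -/
def lapl : H10 Ω →L[ℝ] Hneg Ω :=
  -(innerSL ℝ (E := L2 Ω (EuclideanSpace ℝ (Fin d)))).bilinearComp (grad Ω) (grad Ω)

end Spatial

section Temporal

variable {d : ℕ} (Ω : TopologicalSpace.Opens (EuclideanSpace ℝ (Fin d))) (T : ℝ)

/-- The Bochner space `L²(0,T;V)`. -/
abbrev L2Time (V : Type*) [NormedAddCommGroup V] : Type _ :=
  Lp V 2 (volume.restrict (Ioo (0 : ℝ) T))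

/-- `w` is the weak derivative on `(0,T)` of the function `v : (0,T) → V`:
`∫ v ψ' = -∫ w ψ` (as `V`-valued Bochner integrals) for all `ψ ∈ C₀^∞(0,T)`. -/
def IsWeakTimeDeriv {V : Type*} [NormedAddCommGroup V] [NormedSpace ℝ V]
    (v w : ℝ → V) : Prop :=
  ∀ ψ : TestFunction (⟨Ioo (0 : ℝ) T, isOpen_Ioo⟩ : TopologicalSpace.Opens ℝ) ℝ ⊤,
    ∫ t in Ioo (0 : ℝ) T, deriv ψ t • v t = - ∫ t in Ioo (0 : ℝ) T, ψ t • w t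

/-- `Y = L²(0,T;H¹₀(Ω)) ∩ H¹(0,T;H⁻¹(Ω))`: the `φ ∈ L²(0,T;H¹₀(Ω))` which, viewed as functions
with values in `H⁻¹(Ω)` through `H¹₀ ⊆ L² ⊆ H⁻¹`, have a weak time derivative in
`L²(0,T;H⁻¹(Ω))`. -/
def Y : Set (L2Time T (H10 Ω)) :=
  {φ | ∃ w : L2Time T (Hneg Ω),
    IsWeakTimeDeriv T (fun t => embHneg Ω (toL2 Ω (φ t))) w}

variable {Ω T}

/-- The weak time derivative `∂ₜφ ∈ L²(0,T;H⁻¹(Ω))` of `φ ∈ Y`. -/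
def timeDeriv (φ : Y Ω T) : L2Time T (Hneg Ω) := φ.2.choose

/-- `u` is, on `[0,T]`, a representative of `φ` in `C([0,T];L²(Ω))`. -/
def IsContRep (φ : Y Ω T) (u : ℝ → L2 Ω ℝ) : Prop :=
  ContinuousOn u (Icc 0 T) ∧
    ∀ᵐ t ∂(volume.restrict (Ioo (0 : ℝ) T)), u t = toL2 Ω (φ.1 t)

open Classical in
/-- The value `φ(t) ∈ L²(Ω)`, `t ∈ [0,T]`, of the continuous representative of `φ`
(and `0` if there were no such representative). -/
def timeVal (φ : Y Ω T) (t : ℝ) : L2 Ω ℝ :=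
  if h : ∃ u, IsContRep φ u then h.choose t else 0

/-- The time-symmetric norm
`‖φ‖_{Y*} = (∫₀ᵀ (‖∂ₜφ‖²_{H⁻¹} + ‖∇φ‖²) dt + ‖φ(0)‖² + ‖φ(T)‖²)^{1/2}`. -/
def normYs (φ : Y Ω T) : ℝ :=
  √((∫ t in Ioo (0 : ℝ) T, (normHneg (timeDeriv φ t) ^ 2 + ‖grad Ω (φ.1 t)‖ ^ 2))
    + ‖timeVal φ 0‖ ^ 2 + ‖timeVal φ T‖ ^ 2)

end Temporal

end HeatSpaces

end

open Filter Topology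

/-! Let `S` solve the Dirichlet problem `⟨Φ, v⟩ = (∇SΦ, ∇v)`; it exists by Lax–Milgram and the
Poincaré inequality. Then `‖Φ‖_{H⁻¹} = ‖∇SΦ‖` (`normHneg_eq_norm_grad`), and `Δφ` is represented by
`-φ`, so at each time `‖(∂ₜ+Δ)φ‖² = ‖∇(S∂ₜφ - φ)‖² = ‖∂ₜφ‖² + ‖∇φ‖² - 2⟨∂ₜφ, φ⟩`. After integration
only the energy identity `2∫⟨∂ₜφ, φ⟩ = ‖φ(T)‖² - ‖φ(0)‖²` is missing.

That identity and the continuous representative come together from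
`exists_continuousOn_and_energy_identity`, for an injective bounded `j : V → H` between Hilbert
spaces and without mollifying in time. Through the Riesz isomorphism, the weak derivative becomes an
equation `Bv = c + ∫ω` in `V`, with `B = j*j`. The resolvents `Pₙ = (B + εₙ)⁻¹` commute with `B`,
while the `PₙB` are contractions converging strongly to the identity. The curve `jPₙ(c + ∫ω)` is
absolutely continuous in `H` and satisfies the energy identity with right side `2∫(PₙBv, PₙBω)`.
Dominated convergence passes to the limit; the same identity for `Pₙ - Pₘ` shows that the curves
converge uniformly. -/

/-! ### Absolutely continuous functions and the fundamental theorem of calculus -/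

theorem AbsolutelyContinuousOnInterval.of_dist_le {X Z : Type*} [PseudoMetricSpace X]
    [PseudoMetricSpace Z] {f : ℝ → X} {g : ℝ → Z} {a b : ℝ}
    (hf : AbsolutelyContinuousOnInterval f a b)
    (h : ∀ x ∈ uIcc a b, ∀ y ∈ uIcc a b, dist (g x) (g y) ≤ dist (f x) (f y)) :
    AbsolutelyContinuousOnInterval g a b := by
  rw [absolutelyContinuousOnInterval_iff] at hf ⊢
  intro ε hε
  obtain ⟨δ, hδ, H⟩ := hf ε hε
  refine ⟨δ, hδ, fun E hE hE' => lt_of_le_of_lt (Finset.sum_le_sum fun i hi => ?_) (H E hE hE')⟩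
  exact h _ (hE.1 i hi).1 _ (hE.1 i hi).2

theorem IntervalIntegrable.absolutelyContinuousOnInterval_integral {F : Type*}
    [NormedAddCommGroup F] [NormedSpace ℝ F] {f : ℝ → F} {a b : ℝ}
    (hf : IntervalIntegrable f volume a b) :
    AbsolutelyContinuousOnInterval (fun t => ∫ s in a..t, f s) a b := by
  refine (hf.norm.absolutelyContinuousOnInterval_intervalIntegral (c := a) (by simp)).of_dist_le
    fun x hx y hy => ?_
  have hi : ∀ z ∈ uIcc a b, IntervalIntegrable f volume a z := fun z hz =>
    hf.mono_set (uIcc_subset_uIcc_left hz)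
  rw [dist_eq_norm, dist_eq_norm, intervalIntegral.integral_interval_sub_left (hi x hx) (hi y hy),
    intervalIntegral.integral_interval_sub_left (hi x hx).norm (hi y hy).norm, Real.norm_eq_abs]
  exact intervalIntegral.norm_integral_le_abs_integral_norm

/-- Subtracting the primitive of `f'` leaves an absolutely continuous function whose derivative
vanishes almost everywhere, hence a constant. The a.e. derivative is assumed, so any Banach space is
allowed. -/
theorem AbsolutelyContinuousOnInterval.integral_eq_sub_of_ae_hasDerivAt {F : Type*}
    [NormedAddCommGroup F] [NormedSpace ℝ F] [CompleteSpace F] {f f' : ℝ → F} {a b : ℝ}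
    (hf : AbsolutelyContinuousOnInterval f a b) (hf' : IntervalIntegrable f' volume a b)
    (h : ∀ᵐ x, x ∈ uIcc a b → HasDerivAt f (f' x) x) :
    ∫ x in a..b, f' x = f b - f a := by
  have hg : AbsolutelyContinuousOnInterval (fun t => f t - ∫ s in a..t, f' s) a b :=
    hf.sub hf'.absolutelyContinuousOnInterval_integral
  obtain ⟨C, hC⟩ := hg.const_of_ae_hasDerivAt_zero (by
    filter_upwards [h, hf'.ae_hasDerivAt_integral] with x h1 h2 hx
    have h3 := (h1 hx).sub (h2 hx a left_mem_uIcc)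
    rw [sub_self] at h3
    exact h3)
  have ha := hC a left_mem_uIcc
  have hb := hC b right_mem_uIcc
  simp only [intervalIntegral.integral_same, sub_zero] at ha
  rw [ha, ← hb]
  abel

/-- The scalar function `‖c + ∫ g‖` inherits absolute continuity by the reverse triangle inequality.
Its square has the expected derivative wherever Lebesgue differentiation applies to `g`. -/
theorem norm_sq_integral_sub_norm_sq {H : Type*} [NormedAddCommGroup H] [InnerProductSpace ℝ H]
    [CompleteSpace H] {g : ℝ → H} {a b : ℝ} (hg : IntervalIntegrable g volume a b) (c : H) :
    IntervalIntegrable (fun t => inner ℝ (c + ∫ s in a..t, g s) (g t)) volume a b ∧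
    ‖c + ∫ s in a..b, g s‖ ^ 2 - ‖c‖ ^ 2
      = 2 * ∫ t in a..b, inner ℝ (c + ∫ s in a..t, g s) (g t) := by
  have hac := hg.absolutelyContinuousOnInterval_integral
  have hG : AbsolutelyContinuousOnInterval (fun t => ‖c + ∫ s in a..t, g s‖) a b :=
    hac.of_dist_le fun x _ y _ => by
      refine (dist_norm_norm_le _ _).trans (le_of_eq ?_)
      rw [dist_eq_norm]
      congr 1
      abel
  have hcont : ContinuousOn (fun t => c + ∫ s in a..t, g s) (uIcc a b) :=
    continuousOn_const.add hac.continuousOn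
  have hint : IntervalIntegrable (fun t => inner ℝ (c + ∫ s in a..t, g s) (g t)) volume a b := by
    obtain ⟨C, hC⟩ := isCompact_uIcc.exists_bound_of_continuousOn hcont
    rw [intervalIntegrable_iff] at hg ⊢
    have hm : AEStronglyMeasurable (fun t => c + ∫ s in a..t, g s)
        (volume.restrict (uIoc a b)) :=
      (hcont.mono uIoc_subset_uIcc).aestronglyMeasurable measurableSet_uIoc
    refine Integrable.mono' (hg.norm.const_mul C) (hm.inner hg.aestronglyMeasurable) ?_
    refine (ae_restrict_iff' measurableSet_uIoc).2 (Eventually.of_forall fun t ht => ?_)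
    refine (norm_inner_le_norm _ _).trans ?_
    gcongr
    exact hC t (uIoc_subset_uIcc ht)
  refine ⟨hint, ?_⟩
  have := (hG.mul hG).integral_eq_sub_of_ae_hasDerivAt (hint.const_mul 2) (by
    filter_upwards [hg.ae_hasDerivAt_integral] with x hx hxI
    have := ((hx hxI a left_mem_uIcc).const_add c).norm_sq
    simpa [pow_two, Pi.mul_def] using this)
  rw [intervalIntegral.integral_const_mul] at this
  rw [this]
  simp [pow_two]

/-! ### Weak derivatives in time and primitives -/

section WeakDerivative

variable {V : Type*} [NormedAddCommGroup V] [NormedSpace ℝ V] {T : ℝ}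

theorem TestFunction.exists_Icc_support {a b : ℝ} (hab : a < b)
    (θ : TestFunction (⟨Ioo a b, isOpen_Ioo⟩ : TopologicalSpace.Opens ℝ) ℝ ⊤) :
    ∃ a' b', a < a' ∧ a' ≤ b' ∧ b' < b ∧ ∀ t, t ∉ Icc a' b' → θ t = 0 := by
  -- The midpoint is added only to make the set nonempty when `θ = 0`.
  have hK : IsCompact (insert ((a + b) / 2) (tsupport θ)) := θ.hasCompactSupport.insert _
  have hsub : insert ((a + b) / 2) (tsupport θ) ⊆ Ioo a b :=
    insert_subset ⟨by linarith, by linarith⟩ θ.tsupport_subset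
  obtain ⟨a', ha'⟩ := hK.exists_isLeast (insert_nonempty _ _)
  obtain ⟨b', hb'⟩ := hK.exists_isGreatest (insert_nonempty _ _)
  refine ⟨a', b', (hsub ha'.1).1, ha'.2 hb'.1, (hsub hb'.1).2, fun t ht => ?_⟩
  by_contra hne
  have htK : t ∈ insert ((a + b) / 2) (tsupport θ) :=
    mem_insert_of_mem _ (subset_tsupport _ hne)
  exact ht ⟨ha'.2 htK, hb'.2 htK⟩

/-- The primitive from the left end of the support vanishes to its left trivially, and to its right
because the total integral is zero. -/
theorem TestFunction.exists_deriv_eq_of_integral_eq_zero {a b : ℝ} (hab : a < b)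
    (θ : TestFunction (⟨Ioo a b, isOpen_Ioo⟩ : TopologicalSpace.Opens ℝ) ℝ ⊤)
    (h0 : ∫ t, θ t = 0) :
    ∃ ψ : TestFunction (⟨Ioo a b, isOpen_Ioo⟩ : TopologicalSpace.Opens ℝ) ℝ ⊤,
      deriv ψ = θ := by
  obtain ⟨a', b', haa, hab', hbb, hsupp⟩ := θ.exists_Icc_support hab
  set F : ℝ → ℝ := fun t => ∫ s in a'..t, θ s with hF
  have hd : ∀ t, HasDerivAt F (θ t) t := fun t =>
    intervalIntegral.integral_hasDerivAt_right (θ.continuous.intervalIntegrable _ _)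
      θ.continuous.stronglyMeasurable.stronglyMeasurableAtFilter θ.continuous.continuousAt
  have hderiv : deriv F = θ := funext fun t => (hd t).deriv
  have hzero : ∀ t, t ∉ Icc a' b' → F t = 0 := by
    intro t ht
    by_cases h1 : t < a'
    · rw [hF]
      simp only
      rw [intervalIntegral.integral_symm, intervalIntegral.integral_of_le h1.le,
        integral_Ioc_eq_integral_Ioo, neg_eq_zero]
      refine setIntegral_eq_zero_of_forall_eq_zero fun s hs => hsupp s fun h => ?_
      exact absurd hs.2 (not_lt.2 h.1)
    · have h2 : b' < t := by
        by_contra h2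
        exact ht ⟨not_lt.1 h1, not_lt.1 h2⟩
      rw [hF]
      simp only
      rw [intervalIntegral.integral_of_le (not_lt.1 h1), ← integral_Icc_eq_integral_Ioc,
        setIntegral_eq_integral_of_forall_compl_eq_zero, h0]
      exact fun s hs => hsupp s fun h => hs ⟨h.1, h.2.trans h2.le⟩
  have hts : tsupport F ⊆ Icc a' b' := closure_minimal
    (fun t ht => by_contra fun h => ht (hzero t h)) isClosed_Icc
  refine ⟨⟨F, ?_, isCompact_Icc.of_isClosed_subset (isClosed_tsupport _) hts,
    hts.trans fun t ht => ⟨haa.trans_le ht.1, ht.2.trans_lt hbb⟩⟩, hderiv⟩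
  refine contDiff_infty_iff_deriv.2 ⟨fun t => (hd t).differentiableAt, ?_⟩
  rw [hderiv]
  exact θ.contDiff

theorem TestFunction.integrable_smul {U : TopologicalSpace.Opens ℝ} (θ : TestFunction U ℝ ⊤)
    {g : ℝ → V} {s : Set ℝ} (hg : IntegrableOn g s) :
    IntegrableOn (fun t => θ t • g t) s := by
  obtain ⟨C, hC⟩ := θ.hasCompactSupport.exists_bound_of_continuous θ.continuous
  exact Integrable.bdd_smul hg C θ.continuous.aestronglyMeasurable (Eventually.of_forall hC)

/-- The du Bois-Reymond lemma. For a fixed `η` of integral one, each `χ - (∫χ)η` is the derivative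
of a test function, so `g - ∫ηg` is orthogonal to every `χ`. -/
theorem ae_eq_const_of_integral_deriv_smul_eq_zero [CompleteSpace V] {a b : ℝ} (hab : a < b)
    {g : ℝ → V} (hg : IntegrableOn g (Ioo a b))
    (h : ∀ ψ : TestFunction (⟨Ioo a b, isOpen_Ioo⟩ : TopologicalSpace.Opens ℝ) ℝ ⊤,
      ∫ t in Ioo a b, deriv ψ t • g t = 0) :
    ∃ c, ∀ᵐ t ∂(volume.restrict (Ioo a b)), g t = c := by
  let β : ContDiffBump ((a + b) / 2) := ⟨(b - a) / 8, (b - a) / 4, by linarith, by linarith⟩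
  have hβs : tsupport (β.normed volume) ⊆ Ioo a b := by
    rw [β.tsupport_normed_eq, Real.closedBall_eq_Icc]
    intro t ht
    have h1 : β.rOut = (b - a) / 4 := rfl
    rw [h1] at ht
    constructor <;> linarith [ht.1, ht.2]
  let η : TestFunction (⟨Ioo a b, isOpen_Ioo⟩ : TopologicalSpace.Opens ℝ) ℝ ⊤ :=
    ⟨β.normed volume, β.contDiff_normed, β.hasCompactSupport_normed, hβs⟩
  have hη : ∫ t, η t = 1 := β.integral_normed
  have key : ∀ χ : TestFunction (⟨Ioo a b, isOpen_Ioo⟩ : TopologicalSpace.Opens ℝ) ℝ ⊤,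
      ∫ t in Ioo a b, χ t • (g t - ∫ s in Ioo a b, η s • g s) = 0 := by
    intro χ
    have hiχ : Integrable χ := χ.continuous.integrable_of_hasCompactSupport χ.hasCompactSupport
    have hiη : Integrable η := η.continuous.integrable_of_hasCompactSupport η.hasCompactSupport
    have e0 : ∀ t, (χ - (∫ s, χ s) • η) t = χ t - (∫ s, χ s) * η t := fun t => rfl
    obtain ⟨ψ, hψ⟩ := (χ - (∫ s, χ s) • η).exists_deriv_eq_of_integral_eq_zero hab (by
      simp only [e0]
      rw [integral_sub hiχ (hiη.const_mul _), integral_const_mul, hη]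
      ring)
    have hz := h ψ
    rw [hψ] at hz
    simp only [e0, sub_smul, mul_smul] at hz
    erw [integral_sub (χ.integrable_smul hg) ((η.integrable_smul hg).smul (∫ s, χ s)),
      integral_smul] at hz
    simp only [smul_sub]
    rw [integral_sub (χ.integrable_smul hg) (hiχ.integrableOn.smul_const _), integral_smul_const,
      setIntegral_eq_integral_of_forall_compl_eq_zero (s := Ioo a b) (f := χ), hz]
    exact fun t ht => image_eq_zero_of_notMem_tsupport fun h => ht (χ.tsupport_subset h)
  refine ⟨∫ s in Ioo a b, η s • g s, ?_⟩
  have hfin : IntegrableOn (fun t => g t - ∫ s in Ioo a b, η s • g s) (Ioo a b) :=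
    hg.sub (integrable_const _)
  have := isOpen_Ioo.ae_eq_zero_of_integral_contDiff_smul_eq_zero hfin.locallyIntegrableOn
    (fun χ h1 h2 h3 => by
      have := key ⟨χ, h1, h2, h3⟩
      rw [setIntegral_eq_integral_of_forall_compl_eq_zero] at this
      · exact this
      · intro t ht
        have h0 : χ t = 0 := image_eq_zero_of_notMem_tsupport fun h => ht (h3 h)
        change χ t • _ = _
        rw [h0, zero_smul])
  rw [ae_restrict_iff' measurableSet_Ioo]
  filter_upwards [this] with t ht hI
  exact sub_eq_zero.1 (ht hI)

theorem integral_deriv_smul_primitive [CompleteSpace V] {a b : ℝ} (hab : a < b)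
    {w : ℝ → V} (hw : IntegrableOn w (Ioo a b))
    (ψ : TestFunction (⟨Ioo a b, isOpen_Ioo⟩ : TopologicalSpace.Opens ℝ) ℝ ⊤) :
    IntegrableOn (fun t => ∫ s in a..t, w s) (Ioo a b) ∧
    ∫ t in Ioo a b, deriv ψ t • ∫ s in a..t, w s = - ∫ t in Ioo a b, ψ t • w t := by
  have hwi : IntervalIntegrable w volume a b := by
    rwa [intervalIntegrable_iff_integrableOn_Ioo_of_le hab.le]
  have hac := hwi.absolutelyContinuousOnInterval_integral
  have hψ1 : ContDiff ℝ 1 ψ := ψ.contDiff.of_le (by exact_mod_cast le_top)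
  have hW : IntegrableOn (fun t => ∫ s in a..t, w s) (Ioo a b) := by
    have := hac.continuousOn.integrableOn_compact isCompact_uIcc (μ := volume)
    rw [uIcc_of_le hab.le] at this
    exact this.mono_set Ioo_subset_Icc_self
  refine ⟨hW, ?_⟩
  have hi1 : IntegrableOn (fun t => deriv ψ t • ∫ s in a..t, w s) (Ioo a b) := by
    have hc : Continuous (deriv ψ) := hψ1.continuous_deriv_one
    obtain ⟨C, hC⟩ := ψ.hasCompactSupport.deriv.exists_bound_of_continuous hc
    exact Integrable.bdd_smul hW C hc.aestronglyMeasurable (Eventually.of_forall hC)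
  have hi2 := ψ.integrable_smul hw
  have hz : ∀ t, t ∉ Ioo a b → ψ t = 0 := fun t ht =>
    image_eq_zero_of_notMem_tsupport fun h => ht (ψ.tsupport_subset h)
  have := (hψ1.contDiffOn.absolutelyContinuousOnInterval.smul hac).integral_eq_sub_of_ae_hasDerivAt
    (f' := fun t => ψ t • w t + deriv ψ t • ∫ s in a..t, w s)
    ((intervalIntegrable_iff_integrableOn_Ioo_of_le hab.le).2 (hi2.add hi1)) (by
      filter_upwards [hwi.ae_hasDerivAt_integral] with x hx hxI
      exact ((hψ1.differentiable one_ne_zero x).hasDerivAt).smul (hx hxI a left_mem_uIcc))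
  rw [intervalIntegral.integral_of_le hab.le, integral_Ioc_eq_integral_Ioo, integral_add hi2 hi1]
    at this
  simp only [Pi.smul_apply', hz a (by simp), hz b (by simp), zero_smul, sub_zero] at this
  exact (neg_eq_of_add_eq_zero_right this).symm

theorem HeatSpaces.IsWeakTimeDeriv.ae_eq_const_add_integral [CompleteSpace V] (hT : 0 < T)
    {f w : ℝ → V} (h : HeatSpaces.IsWeakTimeDeriv T f w) (hf : IntegrableOn f (Ioo 0 T))
    (hw : IntegrableOn w (Ioo 0 T)) :
    ∃ c, ∀ᵐ t ∂(volume.restrict (Ioo 0 T)), f t = c + ∫ s in (0 : ℝ)..t, w s := by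
  -- Integrability of the primitive does not involve the test function, so zero serves.
  have hW := (integral_deriv_smul_primitive hT hw 0).1
  obtain ⟨c, hc⟩ := ae_eq_const_of_integral_deriv_smul_eq_zero hT (hf.sub hW) (fun ψ => by
    have hψ1 : ContDiff ℝ 1 ψ := ψ.contDiff.of_le (by exact_mod_cast le_top)
    have hcd : Continuous (deriv ψ) := hψ1.continuous_deriv_one
    obtain ⟨C, hC⟩ := ψ.hasCompactSupport.deriv.exists_bound_of_continuous hcd
    have hi : ∀ g : ℝ → V, IntegrableOn g (Ioo 0 T) →
        IntegrableOn (fun t => deriv ψ t • g t) (Ioo 0 T) := fun g hg =>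
      Integrable.bdd_smul hg C hcd.aestronglyMeasurable (Eventually.of_forall hC)
    simp only [Pi.sub_apply, smul_sub]
    rw [integral_sub (hi _ hf) (hi _ hW), h ψ, (integral_deriv_smul_primitive hT hw ψ).2, sub_self])
  refine ⟨c, hc.mono fun t ht => ?_⟩
  rw [← ht]
  simp

end WeakDerivative

/-! ### The energy identity for an injective map of Hilbert spaces -/

theorem exists_continuousOn_limit_of_norm_sub_sq_le {X H : Type*} [TopologicalSpace X]
    [NormedAddCommGroup H] [CompleteSpace H] {K : Set X}
    {U : ℕ → X → H} {a : ℕ → ℝ} (hU : ∀ n, ContinuousOn (U n) K) (ha : Tendsto a atTop (𝓝 0))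
    (h : ∀ n m, ∀ t ∈ K, ‖U n t - U m t‖ ^ 2 ≤ a n + a m) :
    ∃ u : X → H, ContinuousOn u K ∧ ∀ t ∈ K, Tendsto (fun n => U n t) atTop (𝓝 (u t)) := by
  have hC : UniformCauchySeqOn U atTop K := by
    rw [Metric.uniformCauchySeqOn_iff]
    intro ε hε
    obtain ⟨N, hN⟩ := eventually_atTop.1
      (ha.eventually_lt_const (show 0 < ε ^ 2 / 2 by positivity))
    refine ⟨N, fun m hm n hn t ht => ?_⟩
    rw [dist_eq_norm]
    refine lt_of_pow_lt_pow_left₀ 2 hε.le ?_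
    linarith [h m n t ht, hN m hm, hN n hn]
  have hlim : ∀ t, ∃ y, t ∈ K → Tendsto (fun n => U n t) atTop (𝓝 y) := fun t => by
    by_cases ht : t ∈ K
    · obtain ⟨y, hy⟩ := cauchySeq_tendsto_of_complete (hC.cauchySeq ht)
      exact ⟨y, fun _ => hy⟩
    · exact ⟨0, fun h => absurd h ht⟩
  choose u hu using hlim
  exact ⟨u, (hC.tendstoUniformlyOn_of_tendsto fun t ht => hu t ht).continuousOn
    (Frequently.of_forall hU), hu⟩

section EvolutionTriple

variable {V H : Type*} [NormedAddCommGroup V] [InnerProductSpace ℝ V] [CompleteSpace V]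
  [NormedAddCommGroup H] [InnerProductSpace ℝ H] [CompleteSpace H]

open ContinuousLinearMap in
-- `B + ε` is coercive because `B = j*j` is nonnegative, so Lax–Milgram inverts it. Expanding the
-- square of `x = BPx + εPx`, whose cross term is nonnegative, gives the contraction bound.
theorem ContinuousLinearMap.exists_resolvent_adjoint_comp_self (j : V →L[ℝ] H) {ε : ℝ}
    (hε : 0 < ε) :
    ∃ P : V →L[ℝ] V, (∀ x, (adjoint j ∘L j) (P x) + ε • P x = x) ∧
      (∀ x, P ((adjoint j ∘L j) x) = (adjoint j ∘L j) (P x)) ∧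
      ∀ x, ‖P ((adjoint j ∘L j) x)‖ ≤ ‖x‖ := by
  set B : V →L[ℝ] V := adjoint j ∘L j with hB
  have hBpos : ∀ x, 0 ≤ inner ℝ (B x) x := fun x => by
    rw [hB, comp_apply, adjoint_inner_left]
    exact real_inner_self_nonneg
  let b : V →L[ℝ] V →L[ℝ] ℝ := innerSL ℝ ∘L (B + ε • ContinuousLinearMap.id ℝ V)
  have hb : ∀ x y, b x y = inner ℝ (B x + ε • x) y := fun x y => rfl
  have hco : IsCoercive b := ⟨ε, hε, fun x => by
    rw [hb, inner_add_left, real_inner_smul_left, real_inner_self_eq_norm_mul_norm]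
    linarith [hBpos x]⟩
  set e := hco.continuousLinearEquivOfBilin with he
  have hex : ∀ x, e x = B x + ε • x := fun x => ext_inner_right ℝ fun y => by
    rw [he, hco.continuousLinearEquivOfBilin_apply, hb]
  have hPe : ∀ x, B (e.symm x) + ε • e.symm x = x := fun x => by
    rw [← hex, e.apply_symm_apply]
  have hcomm : ∀ x, e.symm (B x) = B (e.symm x) := fun x => by
    rw [e.symm_apply_eq, hex, ← map_smul, ← map_add, hPe]
  refine ⟨e.symm, hPe, hcomm, fun x => ?_⟩
  change ‖e.symm (B x)‖ ≤ ‖x‖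
  rw [hcomm]
  conv_rhs => rw [← hPe x]
  refine le_of_sq_le_sq ?_ (norm_nonneg _)
  rw [norm_add_sq_real, real_inner_smul_right]
  have := mul_nonneg hε.le (hBpos (e.symm x))
  nlinarith [sq_nonneg ‖ε • e.symm x‖]

open ContinuousLinearMap in
theorem ContinuousLinearMap.dense_range_adjoint_comp_self {j : V →L[ℝ] H}
    (hj : Function.Injective j) : DenseRange (adjoint j ∘L j) := by
  have : (adjoint j ∘L j).range.topologicalClosure = ⊤ := by
    rw [Submodule.topologicalClosure_eq_top_iff, Submodule.eq_bot_iff]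
    intro x hx
    have h0 := (Submodule.mem_orthogonal _ _).1 hx _ ⟨x, rfl⟩
    have h1 : inner ℝ (j x) (j x) = (0 : ℝ) := by
      rw [← adjoint_inner_left]
      exact h0
    exact hj (by rw [inner_self_eq_zero.1 h1, map_zero])
  exact (Submodule.dense_iff_topologicalClosure_eq_top.2 this)

open ContinuousLinearMap in
-- On the range of `B` the error is explicit: `PₙBBy - By = -εₙPₙBy`, of norm at most `εₙ‖y‖`.
-- Density of that range and the uniform bound extend convergence to all of `V`.
theorem ContinuousLinearMap.exists_regularizing_seq {j : V →L[ℝ] H}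
    (hj : Function.Injective j) :
    ∃ P : ℕ → V →L[ℝ] V,
      (∀ n x, P n ((adjoint j ∘L j) x) = (adjoint j ∘L j) (P n x)) ∧
      (∀ n x, ‖P n ((adjoint j ∘L j) x)‖ ≤ ‖x‖) ∧
      ∀ x, Tendsto (fun n => P n ((adjoint j ∘L j) x)) atTop (𝓝 x) := by
  choose P hPe hcomm hbd using fun n : ℕ =>
    j.exists_resolvent_adjoint_comp_self (Nat.one_div_pos_of_nat (α := ℝ) (n := n))
  refine ⟨P, hcomm, hbd, fun x => ?_⟩
  rw [Metric.tendsto_atTop]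
  intro δ hδ
  obtain ⟨y, hy⟩ := (dense_range_adjoint_comp_self hj).exists_dist_lt x
    (show 0 < δ / 3 by linarith)
  set B : V →L[ℝ] V := adjoint j ∘L j
  have h1 : Tendsto (fun n : ℕ => (1 / ((n : ℝ) + 1)) * ‖y‖) atTop (𝓝 0) := by
    simpa using tendsto_one_div_add_atTop_nhds_zero_nat.mul_const ‖y‖
  obtain ⟨N, hN⟩ := eventually_atTop.1 (h1.eventually_lt_const (show 0 < δ / 3 by linarith))
  refine ⟨N, fun n hn => ?_⟩
  have e1 : P n (B (B y)) - B y = -((1 / ((n : ℝ) + 1)) • P n (B y)) := by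
    rw [hcomm n (B y), eq_neg_iff_add_eq_zero, sub_add_eq_add_sub, hPe n (B y), sub_self]
  have e2 : P n (B x) - x = P n (B (x - B y)) + (P n (B (B y)) - B y) + (B y - x) := by
    rw [map_sub, map_sub]
    abel
  have b1 : ‖P n (B (B y)) - B y‖ ≤ (1 / ((n : ℝ) + 1)) * ‖y‖ := by
    rw [e1, norm_neg, norm_smul, Real.norm_of_nonneg (by positivity)]
    gcongr
    exact hbd n y
  have b2 := hbd n (x - B y)
  rw [dist_eq_norm] at hy
  have b3 : ‖B y - x‖ < δ / 3 := by rwa [norm_sub_rev]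
  rw [dist_eq_norm, e2]
  linarith [norm_add_le (P n (B (x - B y)) + (P n (B (B y)) - B y)) (B y - x),
    norm_add_le (P n (B (x - B y))) (P n (B (B y)) - B y), hN n hn]

variable {T : ℝ}

open ContinuousLinearMap in
-- The derivative of the left side is `2(jQBv, jQω)`. Moving `j` across as `j*` and commuting `Q`
-- with `B` makes this `2(QBv, QBω)`, which remains controlled in `V` as `QB` tends to the identity.
theorem norm_sq_sub_norm_sq_of_commute_adjoint_comp_self {j : V →L[ℝ] H} {v ω : ℝ → V} {c : V}
    (hω : IntegrableOn ω (Ioo 0 T))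
    (hvω : ∀ᵐ t ∂(volume.restrict (Ioo 0 T)),
      (adjoint j ∘L j) (v t) = c + ∫ s in (0 : ℝ)..t, ω s)
    {Q : V →L[ℝ] V} (hcomm : ∀ x, Q ((adjoint j ∘L j) x) = (adjoint j ∘L j) (Q x))
    {s t : ℝ} (hs : s ∈ Icc 0 T) (ht : t ∈ Icc 0 T) :
    ‖j (Q (c + ∫ r in (0 : ℝ)..t, ω r))‖ ^ 2 - ‖j (Q (c + ∫ r in (0 : ℝ)..s, ω r))‖ ^ 2
      = 2 * ∫ r in s..t, inner ℝ (Q ((adjoint j ∘L j) (v r))) (Q ((adjoint j ∘L j) (ω r))) := by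
  set B : V →L[ℝ] V := adjoint j ∘L j with hB
  have hBsymm : ∀ x y, inner ℝ (B x) y = inner ℝ x (B y) := fun x y => by
    rw [hB, comp_apply, comp_apply, adjoint_inner_left, adjoint_inner_right]
  have hωi : ∀ t ∈ Icc 0 T, IntervalIntegrable ω volume 0 t := fun t ht => by
    rw [intervalIntegrable_iff_integrableOn_Ioo_of_le ht.1]
    exact hω.mono_set (Ioo_subset_Ioo_right ht.2)
  have hprim : ∀ t ∈ Icc 0 T, j (Q (c + ∫ r in (0 : ℝ)..t, ω r))
      = j (Q c) + ∫ r in (0 : ℝ)..t, j (Q (ω r)) := fun t ht => by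
    rw [map_add, map_add]
    congr 1
    exact ((j ∘L Q).intervalIntegral_comp_comm (hωi t ht)).symm
  have key : ∀ t ∈ Icc 0 T,
      IntervalIntegrable (fun r => inner ℝ (Q (B (v r))) (Q (B (ω r)))) volume 0 t ∧
      ‖j (Q (c + ∫ r in (0 : ℝ)..t, ω r))‖ ^ 2 - ‖j (Q c)‖ ^ 2
        = 2 * ∫ r in (0 : ℝ)..t, inner ℝ (Q (B (v r))) (Q (B (ω r))) := fun t ht => by
    have hg : IntervalIntegrable (fun r => j (Q (ω r))) volume 0 t :=
      ⟨(j ∘L Q).integrable_comp (hωi t ht).1, (j ∘L Q).integrable_comp (hωi t ht).2⟩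
    obtain ⟨h1, h2⟩ := norm_sq_integral_sub_norm_sq hg (j (Q c))
    have hae : ∀ᵐ r ∂(volume.restrict (Ioc 0 t)),
        inner ℝ (j (Q c) + ∫ s in (0 : ℝ)..r, j (Q (ω s))) (j (Q (ω r)))
          = inner ℝ (Q (B (v r))) (Q (B (ω r))) := by
      rw [Measure.restrict_congr_set Ioo_ae_eq_Ioc.symm]
      filter_upwards [ae_restrict_of_ae_restrict_of_subset (Ioo_subset_Ioo_right ht.2) hvω,
        ae_restrict_mem measurableSet_Ioo] with r hr hrI
      rw [← hprim r ⟨hrI.1.le, hrI.2.le.trans ht.2⟩, ← hr, hcomm (ω r), ← hBsymm]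
      exact (adjoint_inner_left j (Q (ω r)) (j (Q (B (v r))))).symm
    have huI : uIoc 0 t = Ioc 0 t := uIoc_of_le ht.1
    refine ⟨h1.congr_ae (huI ▸ hae), ?_⟩
    rw [hprim t ht, h2]
    congr 1
    rw [intervalIntegral.integral_of_le ht.1, intervalIntegral.integral_of_le ht.1]
    exact integral_congr_ae hae
  rw [← intervalIntegral.integral_interval_sub_left (key t ht).1 (key s hs).1, mul_sub,
    ← (key t ht).2, ← (key s hs).2]
  ring

open ContinuousLinearMap in
theorem exists_continuousOn_and_energy_identity (hT : 0 < T) {j : V →L[ℝ] H}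
    (hj : Function.Injective j) {v ω : ℝ → V}
    (hv : MemLp v 2 (volume.restrict (Ioo 0 T))) (hω : MemLp ω 2 (volume.restrict (Ioo 0 T)))
    {c : V} (hvω : ∀ᵐ t ∂(volume.restrict (Ioo 0 T)),
      (adjoint j ∘L j) (v t) = c + ∫ s in (0 : ℝ)..t, ω s) :
    ∃ u : ℝ → H, ContinuousOn u (Icc 0 T) ∧
      (∀ᵐ t ∂(volume.restrict (Ioo 0 T)), u t = j (v t)) ∧
      ‖u T‖ ^ 2 - ‖u 0‖ ^ 2 = 2 * ∫ t in Ioo 0 T, inner ℝ (v t) (ω t) := by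
  obtain ⟨P, hcomm, hbd, hlim⟩ := exists_regularizing_seq hj
  have hωi : IntegrableOn ω (Ioo 0 T) := hω.integrable (by norm_num)
  have henergy := fun {Q : V →L[ℝ] V} (hQ : ∀ x, Q ((adjoint j ∘L j) x) = (adjoint j ∘L j) (Q x))
    {s t : ℝ} (hs : s ∈ Icc 0 T) (ht : t ∈ Icc 0 T) =>
    norm_sq_sub_norm_sq_of_commute_adjoint_comp_self hωi hvω hQ hs ht
  set B : V →L[ℝ] V := adjoint j ∘L j with hB
  set W : ℝ → V := fun t => c + ∫ s in (0 : ℝ)..t, ω s with hW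
  have hWc : ContinuousOn W (Icc 0 T) := by
    have := ((intervalIntegrable_iff_integrableOn_Ioo_of_le hT.le).2
      hωi).absolutelyContinuousOnInterval_integral.continuousOn
    rw [uIcc_of_le hT.le] at this
    exact continuousOn_const.add this
  have hSm : ∀ n, ∀ {f : ℝ → V}, AEStronglyMeasurable f (volume.restrict (Ioo 0 T)) →
      AEStronglyMeasurable (fun t => P n (B (f t))) (volume.restrict (Ioo 0 T)) :=
    fun n f hf => (P n ∘L B).continuous.comp_aestronglyMeasurable hf
  have hprod : Integrable (fun t => ‖v t‖ * ‖ω t‖) (volume.restrict (Ioo 0 T)) :=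
    hv.norm.integrable_mul hω.norm
  set f : ℕ → ℝ → ℝ := fun n t => ‖P n (B (v t)) - v t‖ * ‖ω t‖ with hf
  have hfm : ∀ n, AEStronglyMeasurable (f n) (volume.restrict (Ioo 0 T)) := fun n =>
    ((hSm n hv.1).sub hv.1).norm.mul hω.1.norm
  have hfb : ∀ n t, ‖f n t‖ ≤ 2 * (‖v t‖ * ‖ω t‖) := fun n t => by
    rw [hf, Real.norm_of_nonneg (by positivity), ← mul_assoc]
    refine mul_le_mul_of_nonneg_right ?_ (norm_nonneg _)
    linarith [norm_sub_le (P n (B (v t))) (v t), hbd n (v t)]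
  have hfi : ∀ n, Integrable (f n) (volume.restrict (Ioo 0 T)) := fun n =>
    (hprod.const_mul 2).mono' (hfm n) (Eventually.of_forall (hfb n))
  have hf0 : Tendsto (fun n => ∫ t in Ioo 0 T, f n t) atTop (𝓝 0) := by
    have := tendsto_integral_of_dominated_convergence (f := fun _ => (0 : ℝ)) _ hfm
      (hprod.const_mul 2) (fun n => Eventually.of_forall (hfb n))
      (Eventually.of_forall fun t => by
        have := ((hlim (v t)).sub_const (v t)).norm.mul_const ‖ω t‖
        simpa using this)
    simpa using this
  have : NeBot (ae (volume.restrict (Ioo 0 T))) := by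
    rw [ae_neBot, Ne, Measure.restrict_eq_zero, Real.volume_Ioo]
    simpa using hT
  -- The Cauchy estimate starts at a time where `W τ = B (v τ)`, so that `Pₙ (W τ)` converges. At
  -- time `0` this is unknown, since `c` need not lie in the range of `B`.
  obtain ⟨τ, hτ, hτI⟩ := (hvω.and (ae_restrict_mem measurableSet_Ioo)).exists
  -- The `2` comes from `‖x - y‖² ≤ 2‖x‖² + 2‖y‖²` at `τ`. The `4` is the factor in the energy
  -- identity times the bound `‖(Pₙ - Pₘ)Bω‖ ≤ 2‖ω‖`.
  set a : ℕ → ℝ := fun n => 2 * ‖j (P n (B (v τ))) - j (v τ)‖ ^ 2 + 4 * ∫ t in Ioo 0 T, f n t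
    with ha
  have ha0 : Tendsto a atTop (𝓝 0) := by
    have h1 := (((j.continuous.tendsto _).comp (hlim (v τ))).sub_const (j (v τ))).norm.pow 2
    simpa using (h1.const_mul 2).add (hf0.const_mul 4)
  have hcauchy : ∀ n m, ∀ t ∈ Icc 0 T, ‖j (P n (W t)) - j (P m (W t))‖ ^ 2 ≤ a n + a m := by
    intro n m t ht
    have hE := henergy (Q := P n - P m)
      (fun x => by rw [sub_apply, sub_apply, hcomm, hcomm, map_sub]) (Ioo_subset_Icc_self hτI) ht
    have hsub : uIoc τ t ⊆ Ioc 0 T := fun r hr => by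
      rw [mem_uIoc] at hr
      rcases hr with hr | hr
      · exact ⟨hτI.1.trans hr.1, hr.2.trans ht.2⟩
      · exact ⟨ht.1.trans_lt hr.1, hr.2.trans hτI.2.le⟩
    have hpt : ∀ r, ‖inner ℝ ((P n - P m) (B (v r))) ((P n - P m) (B (ω r)))‖
        ≤ 2 * f n r + 2 * f m r := fun r => by
      refine (norm_inner_le_norm _ _).trans ?_
      have b1 : ‖(P n - P m) (B (v r))‖ ≤ ‖P n (B (v r)) - v r‖ + ‖P m (B (v r)) - v r‖ := by
        rw [sub_apply, ← sub_sub_sub_cancel_right _ _ (v r)]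
        exact norm_sub_le _ _
      have b2 : ‖(P n - P m) (B (ω r))‖ ≤ 2 * ‖ω r‖ := by
        rw [sub_apply]
        linarith [norm_sub_le (P n (B (ω r))) (P m (B (ω r))), hbd n (ω r), hbd m (ω r)]
      refine (mul_le_mul b1 b2 (norm_nonneg _) (by positivity)).trans (le_of_eq ?_)
      simp only [hf]
      ring
    have hsum : IntegrableOn (fun r => 2 * f n r + 2 * f m r) (Ioc 0 T) := by
      rw [integrableOn_Ioc_iff_integrableOn_Ioo]
      exact ((hfi n).const_mul 2).add ((hfi m).const_mul 2)
    have hI : ‖∫ r in τ..t, inner ℝ ((P n - P m) (B (v r))) ((P n - P m) (B (ω r)))‖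
        ≤ 2 * (∫ t in Ioo 0 T, f n t) + 2 * ∫ t in Ioo 0 T, f m t := by
      refine intervalIntegral.norm_integral_le_integral_norm_uIoc.trans ?_
      refine (integral_mono_of_nonneg (Eventually.of_forall fun r => norm_nonneg _)
        (hsum.mono_set hsub) (Eventually.of_forall hpt)).trans ?_
      refine (setIntegral_mono_set hsum (Eventually.of_forall fun r => ?_)
        hsub.eventuallyLE).trans (le_of_eq ?_)
      · exact (norm_nonneg _).trans (hpt r)
      · rw [integral_Ioc_eq_integral_Ioo, integral_add ((hfi n).const_mul 2) ((hfi m).const_mul 2),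
          integral_const_mul, integral_const_mul]
    have hτW : W τ = B (v τ) := hτ.symm
    change ‖j ((P n - P m) (W t))‖ ^ 2 - ‖j ((P n - P m) (W τ))‖ ^ 2 = _ at hE
    have e1 : ∀ r, j ((P n - P m) (W r)) = j (P n (W r)) - j (P m (W r)) := fun r => by
      rw [sub_apply, map_sub]
    rw [e1, e1, hτW] at hE
    have hd : ‖j (P n (B (v τ))) - j (P m (B (v τ)))‖ ^ 2
        ≤ 2 * ‖j (P n (B (v τ))) - j (v τ)‖ ^ 2 + 2 * ‖j (P m (B (v τ))) - j (v τ)‖ ^ 2 := by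
      rw [← sub_sub_sub_cancel_right _ _ (j (v τ))]
      have h1 := norm_sub_le (j (P n (B (v τ))) - j (v τ)) (j (P m (B (v τ))) - j (v τ))
      have h2 := pow_le_pow_left₀ (norm_nonneg _) h1 2
      nlinarith [sq_nonneg (‖j (P n (B (v τ))) - j (v τ)‖ - ‖j (P m (B (v τ))) - j (v τ)‖)]
    rw [Real.norm_eq_abs] at hI
    simp only [ha]
    linarith [le_abs_self (∫ r in τ..t, inner ℝ ((P n - P m) (B (v r))) ((P n - P m) (B (ω r))))]
  obtain ⟨u, huc, hu⟩ := exists_continuousOn_limit_of_norm_sub_sq_le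
    (U := fun n t => j (P n (W t))) (K := Icc 0 T)
    (fun n => (j ∘L P n).continuous.comp_continuousOn hWc) ha0 hcauchy
  refine ⟨u, huc, ?_, ?_⟩
  · filter_upwards [hvω, ae_restrict_mem measurableSet_Ioo] with t ht htI
    refine tendsto_nhds_unique (hu t (Ioo_subset_Icc_self htI)) ?_
    have hWt : W t = B (v t) := ht.symm
    simp only [hWt]
    exact (j.continuous.tendsto _).comp (hlim (v t))
  · have h0 : (0 : ℝ) ∈ Icc 0 T := ⟨le_rfl, hT.le⟩
    have h1 : T ∈ Icc 0 T := ⟨hT.le, le_rfl⟩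
    refine tendsto_nhds_unique (((hu T h1).norm.pow 2).sub ((hu 0 h0).norm.pow 2)) ?_
    have hE : ∀ n, ‖j (P n (W T))‖ ^ 2 - ‖j (P n (W 0))‖ ^ 2
        = 2 * ∫ r in Ioo 0 T, inner ℝ (P n (B (v r))) (P n (B (ω r))) := fun n => by
      refine (henergy (hcomm n) h0 h1).trans ?_
      rw [intervalIntegral.integral_of_le hT.le, integral_Ioc_eq_integral_Ioo]
    simp only [hE]
    refine Tendsto.const_mul 2 (tendsto_integral_of_dominated_convergence _
      (fun n => (hSm n hv.1).inner (hSm n hω.1)) hprod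
      (fun n => Eventually.of_forall fun t => ?_) (Eventually.of_forall fun t => ?_))
    · refine (norm_inner_le_norm _ _).trans ?_
      gcongr
      · exact hbd n _
      · exact hbd n _
    · exact (hlim (v t)).inner (hlim (ω t))

end EvolutionTriple

/-! ### Sobolev spaces: completeness, injectivity into `L²`, Poincaré inequality -/

namespace HeatSpaces

variable {d : ℕ} {Ω : TopologicalSpace.Opens (EuclideanSpace ℝ (Fin d))}

theorem integral_mul_partialDeriv_eq_inner (v : L2 Ω ℝ) (ψ : Test Ω) (i : Fin d) :
    ∫ x in (Ω : Set (EuclideanSpace ℝ (Fin d))), v x * partialDeriv i ψ x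
      = inner ℝ ((memLp_partialDeriv ψ i).toLp _) v := by
  rw [L2.inner_def]
  refine integral_congr_ae ?_
  filter_upwards [(memLp_partialDeriv ψ i).coeFn_toLp] with x hx
  rw [hx]
  rfl

theorem memLp_smul_single (ψ : Test Ω) (i : Fin d) :
    MemLp (fun x => ψ x • EuclideanSpace.single i (1 : ℝ)) 2
      (volume.restrict (Ω : Set (EuclideanSpace ℝ (Fin d)))) :=
  (ContinuousLinearMap.toSpanSingleton ℝ (EuclideanSpace.single i (1 : ℝ))).comp_memLp'
    (memLp_test ψ)

theorem integral_coord_mul_eq_inner (g : L2 Ω (EuclideanSpace ℝ (Fin d))) (ψ : Test Ω)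
    (i : Fin d) :
    ∫ x in (Ω : Set (EuclideanSpace ℝ (Fin d))), g x i * ψ x
      = inner ℝ ((memLp_smul_single ψ i).toLp _) g := by
  rw [L2.inner_def]
  refine integral_congr_ae ?_
  filter_upwards [(memLp_smul_single ψ i).coeFn_toLp] with x hx
  rw [hx, real_inner_smul_left, EuclideanSpace.inner_single_left]
  simp [mul_comm]

/-- Against each test function, the weak gradient condition is an equality of continuous functionals
of `(v, g)`, so it cuts out a closed subspace. -/
instance : CompleteSpace (H1 Ω) := by
  suffices IsClosed (H1 Ω : Set (WithLp 2 (L2 Ω ℝ × L2 Ω (EuclideanSpace ℝ (Fin d))))) from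
    this.completeSpace_coe
  have : (H1 Ω : Set (WithLp 2 (L2 Ω ℝ × L2 Ω (EuclideanSpace ℝ (Fin d)))))
      = ⋂ (ψ : Test Ω) (i : Fin d), {p | inner ℝ ((memLp_partialDeriv ψ i).toLp _) p.fst
        = - inner ℝ ((memLp_smul_single ψ i).toLp _) p.snd} := by
    ext p
    simp only [mem_iInter, mem_ofPred_eq, ← integral_coord_mul_eq_inner,
      ← integral_mul_partialDeriv_eq_inner]
    rfl
  rw [this]
  refine isClosed_iInter fun ψ => isClosed_iInter fun i => isClosed_eq ?_ ?_
  · exact continuous_const.inner (WithLp.fstL 2 ℝ (L2 Ω ℝ) (L2 Ω _)).continuous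
  · exact (continuous_const.inner (WithLp.sndL 2 ℝ (L2 Ω ℝ) (L2 Ω _)).continuous).neg

instance : CompleteSpace (H10 Ω) :=
  (Submodule.isClosed_topologicalClosure (testH1 Ω)).completeSpace_coe

theorem toL2_isWeakGrad (v : H10 Ω) : IsWeakGrad Ω (toL2 Ω v) (grad Ω v) := (toH1 Ω v).2

theorem norm_sq_H10 (v : H10 Ω) : ‖v‖ ^ 2 = ‖toL2 Ω v‖ ^ 2 + ‖grad Ω v‖ ^ 2 :=
  WithLp.prod_norm_sq_eq_of_L2 (toH1 Ω v).1

theorem IsWeakGrad.eq_zero {g : L2 Ω (EuclideanSpace ℝ (Fin d))} (h : IsWeakGrad Ω 0 g) :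
    g = 0 := by
  have hi : ∀ i : Fin d, ∀ᵐ x, x ∈ (Ω : Set (EuclideanSpace ℝ (Fin d))) → g x i = 0 := by
    intro i
    have hloc : LocallyIntegrable (fun x => g x i)
        (volume.restrict (Ω : Set (EuclideanSpace ℝ (Fin d)))) :=
      ((EuclideanSpace.proj (𝕜 := ℝ) i).comp_memLp' (Lp.memLp g)).locallyIntegrable (by norm_num)
    refine Ω.isOpen.ae_eq_zero_of_integral_contDiff_smul_eq_zero
      (locallyIntegrableOn_of_locallyIntegrable_restrict hloc) fun ψ h1 h2 h3 => ?_
    have := h ⟨ψ, h1, h2, h3⟩ i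
    rw [integral_mul_partialDeriv_eq_inner, inner_zero_right, zero_eq_neg,
      setIntegral_eq_integral_of_forall_compl_eq_zero] at this
    · rw [← this]
      exact integral_congr_ae (Eventually.of_forall fun x => mul_comm _ _)
    · intro x hx
      have h0 : ψ x = 0 := image_eq_zero_of_notMem_tsupport fun h => hx (h3 h)
      change _ * ψ x = 0
      rw [h0, mul_zero]
  rw [Lp.eq_zero_iff_ae_eq_zero, EventuallyEq, ae_restrict_iff' Ω.isOpen.measurableSet]
  filter_upwards [ae_all_iff.2 hi] with x hx hxΩ
  ext i
  exact hx i hxΩ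

/-- Elements are pairs `(v, ∇v)`, so this needs uniqueness of the weak gradient, which is the
fundamental lemma of the calculus of variations. -/
theorem toL2_injective : Function.Injective (toL2 Ω) := by
  refine (injective_iff_map_eq_zero _).2 fun v hv => ?_
  have hg : grad Ω v = 0 := IsWeakGrad.eq_zero (hv ▸ toL2_isWeakGrad v)
  have := norm_sq_H10 v
  rw [hv, hg] at this
  simpa using this

/-- The product of a test function with the `i`-th coordinate function. -/
noncomputable def coordMulTest (i : Fin d) (ψ : Test Ω) : Test Ω where
  toFun x := x i * ψ x
  contDiff' := (EuclideanSpace.proj (𝕜 := ℝ) i).contDiff.mul ψ.contDiff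
  hasCompactSupport' := ψ.hasCompactSupport.mul_left
  tsupport_subset' := (tsupport_mul_subset_right).trans ψ.tsupport_subset

theorem partialDeriv_coordMulTest (i : Fin d) (ψ : Test Ω) (x : EuclideanSpace ℝ (Fin d)) :
    partialDeriv i (coordMulTest i ψ) x = ψ x + x i * partialDeriv i ψ x := by
  have h1 : HasFDerivAt (fun y : EuclideanSpace ℝ (Fin d) => y i)
      (EuclideanSpace.proj (𝕜 := ℝ) i) x := (EuclideanSpace.proj (𝕜 := ℝ) i).hasFDerivAt
  have h2 : HasFDerivAt ψ (fderiv ℝ ψ x) x :=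
    (ψ.contDiff.differentiable (by simp) x).hasFDerivAt
  have h3 : fderiv ℝ (coordMulTest i ψ) x = _ := (h1.mul h2).fderiv
  rw [partialDeriv, h3, partialDeriv]
  simp [add_comm]

/-- The product rule gives `∫ψ² + J` and integration by parts gives `-J`, with `J = ∫ xᵢψ∂ᵢψ`;
eliminate `J`. -/
theorem integral_coord_mul_mul_partialDeriv (i : Fin d) (ψ : Test Ω) :
    ∫ x, ψ x * partialDeriv i (coordMulTest i ψ) x = (1 / 2) * ∫ x, ψ x ^ 2 := by
  have hd : ∀ χ : Test Ω, Differentiable ℝ χ := fun χ => χ.contDiff.differentiable (by simp)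
  have hc : ∀ χ : Test Ω, Continuous (partialDeriv i χ) := fun χ =>
    (χ.contDiff.continuous_fderiv (by simp)).clm_apply continuous_const
  have hI : ∀ χ : Test Ω, ∀ f : EuclideanSpace ℝ (Fin d) → ℝ, Continuous f →
      Integrable (fun x => χ x * f x) := fun χ f hf =>
    (χ.continuous.mul hf).integrable_of_hasCompactSupport χ.hasCompactSupport.mul_right
  have hI' : ∀ χ : Test Ω, ∀ f : EuclideanSpace ℝ (Fin d) → ℝ, Continuous f →
      Integrable (fun x => f x * χ x) := fun χ f hf => by
    simpa only [mul_comm] using hI χ f hf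
  have hparts : ∫ x, ψ x * partialDeriv i (coordMulTest i ψ) x
      = - ∫ x, partialDeriv i ψ x * coordMulTest i ψ x :=
    integral_mul_fderiv_eq_neg_fderiv_mul_of_integrable (hI' _ _ (hc _)) (hI _ _ (hc _))
      (hI _ _ (coordMulTest i ψ).continuous) (fun _ _ => hd _ _) (fun _ _ => hd _ _)
  have hsplit : ∫ x, ψ x * partialDeriv i (coordMulTest i ψ) x
      = (∫ x, ψ x ^ 2) + ∫ x, partialDeriv i ψ x * coordMulTest i ψ x := by
    rw [← integral_add (by simpa only [pow_two] using hI ψ _ ψ.continuous) (hI' _ _ (hc _))]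
    refine integral_congr_ae (Eventually.of_forall fun x => ?_)
    simp only [partialDeriv_coordMulTest]
    change _ = _ + _ * (x i * ψ x)
    ring
  linarith

/-- Testing the weak gradient with `xᵢψ` yields `½‖v‖² = -(xᵢgᵢ, v) ≤ R‖g‖‖v‖`. The stored gradient
never has to be identified with the classical one. -/
theorem norm_fst_le_of_mem_testH1 {R : ℝ} (hR : ∀ x ∈ Ω, ‖x‖ ≤ R) (i : Fin d)
    {p : H1 Ω} (hp : p ∈ testH1 Ω) : ‖p.1.fst‖ ≤ 2 * R * ‖p.1.snd‖ := by
  obtain ⟨ψ, hψ⟩ := hp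
  set v := p.1.fst
  set g := p.1.snd
  have hzero : ∀ x, x ∉ (Ω : Set (EuclideanSpace ℝ (Fin d))) → ψ x = 0 := fun x hx =>
    image_eq_zero_of_notMem_tsupport fun h => hx (ψ.tsupport_subset h)
  have hbd : ∀ᵐ x ∂(volume.restrict (Ω : Set (EuclideanSpace ℝ (Fin d)))),
      ‖x i * g x i‖ ≤ R * ‖g x‖ := by
    filter_upwards [ae_restrict_mem Ω.isOpen.measurableSet] with x hx
    rw [norm_mul]
    exact mul_le_mul ((PiLp.norm_apply_le x i).trans (hR x hx)) (PiLp.norm_apply_le (g x) i)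
      (norm_nonneg _) ((norm_nonneg _).trans (hR x hx))
  have hm : MemLp (fun x => x i * g x i) 2
      (volume.restrict (Ω : Set (EuclideanSpace ℝ (Fin d)))) :=
    MemLp.of_le_mul (Lp.memLp g)
      ((EuclideanSpace.proj (𝕜 := ℝ) i).continuous.aestronglyMeasurable.mul
        ((EuclideanSpace.proj (𝕜 := ℝ) i).continuous.comp_aestronglyMeasurable (Lp.memLp g).1)) hbd
  have hnorm : ‖hm.toLp‖ ≤ R * ‖g‖ := Lp.norm_le_mul_norm_of_ae_le_mul (by
    filter_upwards [hm.coeFn_toLp, hbd] with x hx hx'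
    rwa [hx])
  have e1 : ‖v‖ ^ 2 = ∫ x, ψ x ^ 2 := by
    rw [← real_inner_self_eq_norm_sq, L2.inner_def,
      ← setIntegral_eq_integral_of_forall_compl_eq_zero
        (s := (Ω : Set (EuclideanSpace ℝ (Fin d)))) (f := fun x => ψ x ^ 2)
        (fun x hx => by simp [hzero x hx])]
    refine integral_congr_ae ?_
    filter_upwards [hψ] with x hx
    rw [hx, real_inner_self_eq_norm_sq, Real.norm_eq_abs, sq_abs]
  have e2 : ∫ x in (Ω : Set (EuclideanSpace ℝ (Fin d))),
      v x * partialDeriv i (coordMulTest i ψ) x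
        = ∫ x, ψ x * partialDeriv i (coordMulTest i ψ) x := by
    rw [← setIntegral_eq_integral_of_forall_compl_eq_zero
        (s := (Ω : Set (EuclideanSpace ℝ (Fin d))))
        (f := fun x => ψ x * partialDeriv i (coordMulTest i ψ) x)
        (fun x hx => by rw [hzero x hx, zero_mul])]
    refine integral_congr_ae ?_
    filter_upwards [hψ] with x hx
    rw [hx]
  have e3 : ∫ x in (Ω : Set (EuclideanSpace ℝ (Fin d))), g x i * coordMulTest i ψ x
      = inner ℝ hm.toLp v := by
    rw [L2.inner_def]
    refine integral_congr_ae ?_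
    filter_upwards [hψ, hm.coeFn_toLp] with x hx hx'
    rw [hx, hx']
    change g x i * (x i * ψ x) = ψ x * (x i * g x i)
    ring
  have hw : ∫ x in (Ω : Set (EuclideanSpace ℝ (Fin d))),
      v x * partialDeriv i (coordMulTest i ψ) x = _ := p.2 (coordMulTest i ψ) i
  rw [e2, integral_coord_mul_mul_partialDeriv, ← e1, e3] at hw
  have h1 := abs_real_inner_le_norm hm.toLp v
  have h2 := neg_abs_le (inner ℝ hm.toLp v)
  have h3 := mul_le_mul_of_nonneg_right hnorm (norm_nonneg v)
  -- The sign of `R` is not given, but `hnorm` forces `0 ≤ R‖g‖`. The negated claim thus makes `‖v‖`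
  -- positive, and it can be cancelled.
  by_contra! hlt
  have hpos : 0 < ‖v‖ := lt_of_le_of_lt
    (by linarith [(norm_nonneg hm.toLp).trans hnorm]) hlt
  nlinarith

theorem exists_norm_toL2_le_mul_norm_grad (hd : 1 ≤ d)
    (hΩ : Bornology.IsBounded (Ω : Set (EuclideanSpace ℝ (Fin d)))) :
    ∃ C, 0 ≤ C ∧ ∀ v : H10 Ω, ‖toL2 Ω v‖ ≤ C * ‖grad Ω v‖ := by
  obtain ⟨R, hR0, hR⟩ := hΩ.exists_pos_norm_le
  refine ⟨2 * R, by positivity, fun v => ?_⟩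
  have hclosed : IsClosed {p : H1 Ω | ‖p.1.fst‖ ≤ 2 * R * ‖p.1.snd‖} := by
    refine isClosed_le ?_ ?_
    · exact ((WithLp.fstL 2 ℝ (L2 Ω ℝ) (L2 Ω _)).continuous.comp continuous_subtype_val).norm
    · exact continuous_const.mul
        ((WithLp.sndL 2 ℝ (L2 Ω ℝ) (L2 Ω _)).continuous.comp continuous_subtype_val).norm
  exact closure_minimal (fun p hp => norm_fst_le_of_mem_testH1 hR ⟨0, hd⟩ hp) hclosed v.2

end HeatSpaces

/-! ### The dual norm, traces in time, and the norm identity -/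

namespace HeatSpaces

variable {d : ℕ} {Ω : TopologicalSpace.Opens (EuclideanSpace ℝ (Fin d))} {T : ℝ}

/-- Poincaré bounds the full norm by `‖v‖² ≤ (C² + 1)‖∇v‖²`, so the Dirichlet form is coercive. -/
theorem exists_dirichlet_solution (hd : 1 ≤ d)
    (hΩ : Bornology.IsBounded (Ω : Set (EuclideanSpace ℝ (Fin d)))) :
    ∃ S : Hneg Ω →L[ℝ] H10 Ω, ∀ Φ v, Φ v = inner ℝ (grad Ω (S Φ)) (grad Ω v) := by
  obtain ⟨C, hC, hP⟩ := exists_norm_toL2_le_mul_norm_grad hd hΩ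
  let b : H10 Ω →L[ℝ] H10 Ω →L[ℝ] ℝ :=
    (innerSL ℝ (E := L2 Ω (EuclideanSpace ℝ (Fin d)))).bilinearComp (grad Ω) (grad Ω)
  have hb : ∀ v w, b v w = inner ℝ (grad Ω v) (grad Ω w) := fun v w => rfl
  have hco : IsCoercive b := ⟨(C ^ 2 + 1)⁻¹, by positivity, fun v => by
    rw [hb, real_inner_self_eq_norm_sq, mul_assoc, ← pow_two, inv_mul_le_iff₀ (by positivity),
      norm_sq_H10]
    nlinarith [pow_le_pow_left₀ (norm_nonneg _) (hP v) 2]⟩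
  refine ⟨hco.continuousLinearEquivOfBilin.symm.toContinuousLinearMap ∘L
    (InnerProductSpace.toDual ℝ (H10 Ω)).symm.toContinuousLinearEquiv.toContinuousLinearMap,
    fun Φ v => ?_⟩
  rw [← hb, ← hco.continuousLinearEquivOfBilin_apply]
  simp

/-- Cauchy–Schwarz bounds each quotient, and `v = z` attains the bound unless `∇z = 0`, when all
quotients vanish. -/
theorem normHneg_eq_norm_grad {Φ : Hneg Ω} {z : H10 Ω}
    (h : ∀ v, Φ v = inner ℝ (grad Ω z) (grad Ω v)) : normHneg Φ = ‖grad Ω z‖ := by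
  have hle : ∀ v : {v : H10 Ω // v ≠ 0}, Φ v.1 / ‖grad Ω v.1‖ ≤ ‖grad Ω z‖ := fun v => by
    rw [h]
    exact div_le_of_le_mul₀ (norm_nonneg _) (norm_nonneg _) (real_inner_le_norm _ _)
  refine le_antisymm (Real.iSup_le hle (norm_nonneg _)) ?_
  by_cases hz : grad Ω z = 0
  · rw [normHneg]
    simp [h, hz]
  · have hz0 : z ≠ 0 := fun h0 => hz (by rw [h0, map_zero])
    have hb : BddAbove (range fun v : {v : H10 Ω // v ≠ 0} => Φ v.1 / ‖grad Ω v.1‖) :=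
      ⟨_, forall_mem_range.2 hle⟩
    refine le_trans (le_of_eq ?_) (le_ciSup hb ⟨z, hz0⟩)
    rw [h, real_inner_self_eq_norm_mul_norm, mul_div_cancel_right₀ _ (norm_ne_zero_iff.2 hz)]

theorem exists_isContRep_and_energy_identity (hT : 0 < T) (φ : Y Ω T) :
    ∃ u : ℝ → L2 Ω ℝ, IsContRep φ u ∧
      ‖u T‖ ^ 2 - ‖u 0‖ ^ 2 = 2 * ∫ t in Ioo 0 T, timeDeriv φ t (φ.1 t) := by
  have hφ : IsWeakTimeDeriv T (fun t => embHneg Ω (toL2 Ω (φ.1 t))) (timeDeriv φ) :=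
    φ.2.choose_spec
  have hφm := Lp.memLp φ.1
  have hwm := Lp.memLp (timeDeriv φ)
  let R : Hneg Ω →L[ℝ] H10 Ω :=
    (InnerProductSpace.toDual ℝ (H10 Ω)).symm.toContinuousLinearEquiv.toContinuousLinearMap
  have hR : ∀ Φ v, inner ℝ (R Φ) v = Φ v := fun Φ v => InnerProductSpace.toDual_symm_apply
  have hwi : IntegrableOn (timeDeriv φ) (Ioo 0 T) := hwm.integrable (by norm_num)
  have hvi : IntegrableOn (fun t => embHneg Ω (toL2 Ω (φ.1 t))) (Ioo 0 T) :=
    (embHneg Ω ∘L toL2 Ω).integrable_comp (hφm.integrable (by norm_num))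
  obtain ⟨c, hc⟩ := hφ.ae_eq_const_add_integral hT hvi hwi
  obtain ⟨u, hu, hae, henergy⟩ := exists_continuousOn_and_energy_identity hT
    (toL2_injective (Ω := Ω)) hφm (R.comp_memLp' hwm) (c := R c) (by
      filter_upwards [hc, ae_restrict_mem measurableSet_Ioo] with t ht htI
      have hi : IntervalIntegrable (timeDeriv φ) volume 0 t := by
        rw [intervalIntegrable_iff_integrableOn_Ioo_of_le htI.1.le]
        exact hwi.mono_set (Ioo_subset_Ioo_right htI.2.le)
      have e1 : ∫ s in (0 : ℝ)..t, (R ∘ timeDeriv φ) s = R (∫ s in (0 : ℝ)..t, timeDeriv φ s) :=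
        R.intervalIntegral_comp_comm hi
      rw [e1, ← map_add, ← ht]
      -- The Riesz map carries the embedding of `H¹₀` into `H⁻¹` to `j*j`, with `j = toL2 Ω`.
      refine ext_inner_right ℝ fun v => ?_
      rw [hR, ContinuousLinearMap.comp_apply, ContinuousLinearMap.adjoint_inner_left]
      rfl)
  refine ⟨u, ⟨hu, hae⟩, henergy.trans ?_⟩
  congr 1
  refine integral_congr_ae (Eventually.of_forall fun t => ?_)
  change inner ℝ (φ.1 t) (R (timeDeriv φ t)) = _
  rw [real_inner_comm, hR]

theorem IsContRep.eqOn (hT : 0 < T) {φ : Y Ω T} {u u' : ℝ → L2 Ω ℝ} (h : IsContRep φ u)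
    (h' : IsContRep φ u') : EqOn u u' (Icc 0 T) := by
  refine Measure.eqOn_Icc_of_ae_eq volume hT.ne ?_ h.1 h'.1
  rw [Measure.restrict_congr_set Ioo_ae_eq_Icc.symm]
  filter_upwards [h.2, h'.2] with t ht ht'
  rw [ht, ht']

theorem IsContRep.timeVal {φ : Y Ω T} {u : ℝ → L2 Ω ℝ} (h : IsContRep φ u) :
    IsContRep φ (timeVal φ) := by
  have hex : ∃ u, IsContRep φ u := ⟨u, h⟩
  have : HeatSpaces.timeVal φ = hex.choose := funext fun t => dif_pos hex
  rw [this]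
  exact hex.choose_spec

end HeatSpaces

theorem mainTheorem12 {d : ℕ} (hd : 1 ≤ d)
    (Ω : TopologicalSpace.Opens (EuclideanSpace ℝ (Fin d)))
    (hΩ : Bornology.IsBounded (Ω : Set (EuclideanSpace ℝ (Fin d))))
    (T : ℝ) (hT : 0 < T) (φ : HeatSpaces.Y Ω T) :
    -- every quantity in the identity is well defined
    (HeatSpaces.IsContRep φ (HeatSpaces.timeVal φ) ∧
      (∀ u, HeatSpaces.IsContRep φ u → EqOn u (HeatSpaces.timeVal φ) (Icc 0 T)) ∧
      IntegrableOn (fun t => HeatSpaces.normHneg (HeatSpaces.timeDeriv φ t) ^ 2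
        + ‖HeatSpaces.grad Ω (φ.1 t)‖ ^ 2) (Ioo 0 T) ∧
      IntegrableOn (fun t => HeatSpaces.normHneg
        (HeatSpaces.timeDeriv φ t + HeatSpaces.lapl Ω (φ.1 t)) ^ 2) (Ioo 0 T)) ∧
    -- the identity
    HeatSpaces.normYs φ ^ 2 = 2 * ‖HeatSpaces.timeVal φ T‖ ^ 2
      + ∫ t in Ioo (0 : ℝ) T, HeatSpaces.normHneg
          (HeatSpaces.timeDeriv φ t + HeatSpaces.lapl Ω (φ.1 t)) ^ 2 := by
  open HeatSpaces in
  obtain ⟨u, hu, henergy⟩ := exists_isContRep_and_energy_identity hT φ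
  have hval := hu.timeVal
  rw [hu.eqOn hT hval ⟨hT.le, le_rfl⟩, hu.eqOn hT hval ⟨le_rfl, hT.le⟩] at henergy
  obtain ⟨S, hS⟩ := exists_dirichlet_solution hd hΩ
  have hφm := Lp.memLp φ.1
  have hwm := Lp.memLp (timeDeriv φ)
  have hN : ∀ t, normHneg (timeDeriv φ t) = ‖grad Ω (S (timeDeriv φ t))‖ := fun t =>
    normHneg_eq_norm_grad (hS _)
  have hN' : ∀ t, normHneg (timeDeriv φ t + lapl Ω (φ.1 t)) ^ 2
      = normHneg (timeDeriv φ t) ^ 2 + ‖grad Ω (φ.1 t)‖ ^ 2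
        - 2 * timeDeriv φ t (φ.1 t) := fun t => by
    rw [normHneg_eq_norm_grad (z := S (timeDeriv φ t) - φ.1 t), hN, map_sub, norm_sub_sq_real,
      ← hS]
    · ring
    · intro v
      rw [map_sub, inner_sub_left, ← hS, sub_eq_add_neg]
      rfl
  -- Rewriting the dual norm as `‖∇S·‖`, with `S` continuous linear, makes the supremum measurable
  -- in time and square integrable.
  have hi1 : IntegrableOn (fun t => normHneg (timeDeriv φ t) ^ 2
      + ‖grad Ω (φ.1 t)‖ ^ 2) (Ioo 0 T) := by
    simp only [hN]
    exact (((grad Ω ∘L S).comp_memLp' hwm).integrable_norm_pow two_ne_zero).add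
      (((grad Ω).comp_memLp' hφm).integrable_norm_pow two_ne_zero)
  have hi2 : IntegrableOn (fun t => timeDeriv φ t (φ.1 t)) (Ioo 0 T) := by
    refine Integrable.congr (f := fun t => inner ℝ (grad Ω (S (timeDeriv φ t))) (grad Ω (φ.1 t)))
      ?_ (Eventually.of_forall fun t => (hS _ _).symm)
    have h1 := (grad Ω ∘L S).comp_memLp' hwm
    have h2 := (grad Ω).comp_memLp' hφm
    exact (h1.norm.integrable_mul h2.norm).mono' (h1.1.inner h2.1)
      (Eventually.of_forall fun t => norm_inner_le_norm _ _)
  have hi3 : IntegrableOn (fun t => normHneg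
      (timeDeriv φ t + lapl Ω (φ.1 t)) ^ 2) (Ioo 0 T) := by
    simp only [hN']
    exact hi1.sub (hi2.const_mul 2)
  refine ⟨⟨hval, fun u' hu' => hu'.eqOn hT hval, hi1, hi3⟩, ?_⟩
  have hpos : 0 ≤ (∫ t in Ioo (0 : ℝ) T, (normHneg (timeDeriv φ t) ^ 2 + ‖grad Ω (φ.1 t)‖ ^ 2))
      + ‖timeVal φ 0‖ ^ 2 + ‖timeVal φ T‖ ^ 2 := by
    have : 0 ≤ ∫ t in Ioo (0 : ℝ) T, (normHneg (timeDeriv φ t) ^ 2 + ‖grad Ω (φ.1 t)‖ ^ 2) :=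
      integral_nonneg fun t => by positivity
    positivity
  rw [normYs, Real.sq_sqrt hpos]
  simp only [hN']
  rw [integral_sub hi1 (hi2.const_mul 2), integral_const_mul]
  linarith
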